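/- Let $K$ be a field and let $E$ be a finite-dimensional evolution $K$-algebra, that is, a (not necessarily associative or unital) $K$-algebra with a natural basis $e_1,\dots,e_n$: $e_ie_j=0$ for $i\neq j$ and $e_i^2=\sum_j\omega_{ji}e_j$ with $\omega_{ji}\in K$. Fix $\lambda_0,\dots,\lambda_3\in K$ and put $p(z,w)=\lambda_0zw+\lambda_1zw^*+\lambda_2z^*w+\lambda_3z^*w^*$. Let $R=K[x_1,\dots,x_n,x_1^*,\dots,x_n^*]$ with the involution $x_i\leftrightarrow x_i^*$, let $I$ be the $*$-ideal of $R$ that is $*$-generated by all $p(x_i,x_j)$ with $i\ne j$ and all $p(x_i,x_i)-\sum_j\omega_{ji}x_j$, and let the tight universal $p$-algebra $\mathcal T_p$ be the (not necessarily unital) subalgebra of $R/I$ generated by the classes of the $x_i$ and $x_i^*$, with the involution $*$ induced from $R$. Let $\rho\colon E\to\mathcal T_p$ be the linear map $e_i\mapsto \bar x_i$. Let $\mathcal H$ be the Hopf algebra representing the group scheme $S\mapsto\mathrm{Aut}_S(S\otimes_K E)$ on commutative $K$-algebras, and let $\mathrm{Aut}(E)$ be the group of $K$-algebra automorphisms of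 $E$. Assume that $\mathcal T_p\cong\mathcal H$ as $K$-algebras. Say that $\mathcal H$ is of truncated polynomial form if $\mathrm{char}\,K=q$ is a prime and $\mathcal H\cong K[y_1,\dots,y_m]/(y_1^{q^{r_1}},\dots,y_m^{q^{r_m}})$ as $K$-algebras for some $m\ge1$ and $r_1,\dots,r_m\geq 1$. Suppose first that $E$ is perfect, i.e. $E^2=E$. 1. If $*$ is the identity of $\mathcal T_p$, then $\ker\rho\neq E$, $\ker\rho$ is an ideal of $E$ and $E/\ker\rho$ is associative; if moreover $E$ is not associative, then $\rho$ is not injective. 2. If $*$ is not the identity of $\mathcal T_p$, then $\mathcal H\not\cong K$ as $K$-algebras. Hence, if moreover $K$ is algebraically closed, then $\mathrm{Aut}(E)\ne1$ or $\mathcal H$ is of truncated polynomial form. In particular, if $E$ is simple ($E^2\neq0$ and $E$ has no ideals other than $0$ and $E$) and not associative, then $\mathrm{Aut}(E)\neq 1$ or $\mathcal H$ is of truncated polynomial form. So, if in addition $\mathrm{char}\,K=0$, then $\mathrm{Aut}(E)\neq1$. -/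

import Mathlib

open scoped TensorProduct

noncomputable section

namespace EvoAlg

universe u v w

/-! ### Nonassociative algebras -/

/-- `E² = E`: the products span the whole algebra. -/
def IsPerfect (K : Type u) (E : Type v) [Field K] [NonUnitalNonAssocRing E] [Module K E] : Prop :=
  Submodule.span K {z : E | ∃ x y : E, z = x * y} = ⊤

/-- The multiplication is associative. -/
def IsAssoc (E : Type v) [Mul E] : Prop := ∀ x y z : E, x * y * z = x * (y * z)

/-- `E² ≠ 0`, and the only two-sided algebra ideals are `0` and `E`. -/
def IsSimpleAlg (K : Type u) (E : Type v) [Field K] [NonUnitalNonAssocRing E] [Module K E] : Prop :=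
  (∃ x y : E, x * y ≠ 0) ∧
    ∀ J : Submodule K E, (∀ x : E, ∀ y ∈ J, x * y ∈ J ∧ y * x ∈ J) → J = ⊥ ∨ J = ⊤

/-- The group of `R`-algebra automorphisms of a (not necessarily unital or associative)
`R`-algebra. -/
def algAut (R : Type u) (E : Type v) [CommRing R] [NonUnitalNonAssocRing E] [Module R E] :
    Subgroup (E ≃ₗ[R] E) where
  carrier := {f | ∀ x y : E, f (x * y) = f x * f y}
  one_mem' := fun _ _ => rfl
  mul_mem' := by
    intro f g hf hg x y
    have hf' : ∀ x y : E, f (x * y) = f x * f y := hf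
    have hg' : ∀ x y : E, g (x * y) = g x * g y := hg
    simp only [LinearEquiv.mul_apply]
    rw [hg', hf']
  inv_mem' := by
    intro f hf x y
    apply f.injective
    have hf' : ∀ x y : E, f (x * y) = f x * f y := hf
    have h : ∀ z : E, f (f⁻¹ z) = z := fun z => f.apply_symm_apply z
    rw [hf', h, h, h]

/-- A natural basis: distinct basis vectors have product zero.  An algebra that has such a basis
is an evolution algebra. -/
def IsNaturalBasis {K : Type u} {E : Type v} {ι : Type w} [Field K] [NonUnitalNonAssocRing E]
    [Module K E] (b : Module.Basis ι K E) : Prop :=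
  ∀ i j : ι, i ≠ j → b i * b j = 0

/-! ### The universal associative and commutative representation -/

section Representation

variable {K : Type u} {E : Type v} {ι : Type w} [Field K] [NonUnitalNonAssocRing E] [Module K E]
  [Fintype ι]

/-- The involution `x_i ↔ x_i^*` of the polynomial algebra in the variables
`x_i = X (Sum.inl i)` and `x_i^* = X (Sum.inr i)`. -/
def starR (K : Type u) (ι : Type w) [Field K] :
    MvPolynomial (ι ⊕ ι) K →ₐ[K] MvPolynomial (ι ⊕ ι) K :=
  MvPolynomial.rename Sum.swap

theorem starR_starR (K : Type u) (ι : Type w) [Field K] (f : MvPolynomial (ι ⊕ ι) K) :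
    starR K ι (starR K ι f) = f := by
  simp [starR, MvPolynomial.rename_rename]

/-- `p(z, w) = λ₀ z w + λ₁ z w^* + λ₂ z^* w + λ₃ z^* w^*`, where `s` is the involution. -/
def pProd (c : Fin 4 → K) {A : Type*} [CommRing A] [Algebra K A] (s : A → A) (z w : A) : A :=
  c 0 • (z * w) + c 1 • (z * s w) + c 2 • (s z * w) + c 3 • (s z * s w)

/-- The elements `p(x_i, x_j)` for `i ≠ j` and `p(x_i, x_i) - ∑ j, ω_{ji} x_j`, where
`e_i² = ∑ j, ω_{ji} e_j`. -/
def relSet (b : Module.Basis ι K E) (c : Fin 4 → K) : Set (MvPolynomial (ι ⊕ ι) K) :=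
  {f | ∃ i j : ι, i ≠ j ∧
      f = pProd c (starR K ι) (MvPolynomial.X (Sum.inl i)) (MvPolynomial.X (Sum.inl j))} ∪
  {f | ∃ i : ι,
      f = pProd c (starR K ι) (MvPolynomial.X (Sum.inl i)) (MvPolynomial.X (Sum.inl i)) -
        ∑ j, MvPolynomial.C (b.repr (b i * b i) j) * MvPolynomial.X (Sum.inl j)}

/-- The `*`-ideal that is `*`-generated by `relSet`. -/
def relIdeal (b : Module.Basis ι K E) (c : Fin 4 → K) : Ideal (MvPolynomial (ι ⊕ ι) K) :=
  Ideal.span (relSet b c ∪ starR K ι '' relSet b c)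

/-- The universal unital `p`-algebra. -/
abbrev Up (b : Module.Basis ι K E) (c : Fin 4 → K) : Type (max u w) :=
  MvPolynomial (ι ⊕ ι) K ⧸ relIdeal b c

/-- The class of a variable `x_i` or `x_i^*` in the universal unital `p`-algebra. -/
def gen (b : Module.Basis ι K E) (c : Fin 4 → K) (s : ι ⊕ ι) : Up b c :=
  Ideal.Quotient.mk (relIdeal b c) (MvPolynomial.X s)

theorem relIdeal_le_comap (b : Module.Basis ι K E) (c : Fin 4 → K) :
    relIdeal b c ≤ (relIdeal b c).comap (starR K ι) := by
  unfold relIdeal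
  rw [Ideal.span_le]
  rintro f (hf | ⟨g, hg, rfl⟩)
  · exact Ideal.subset_span (Or.inr ⟨f, hf, rfl⟩)
  · refine Ideal.subset_span (Or.inl ?_)
    rw [starR_starR K ι]
    exact hg

/-- The canonical involution of the universal unital `p`-algebra. -/
def starU (b : Module.Basis ι K E) (c : Fin 4 → K) : Up b c →ₐ[K] Up b c :=
  Ideal.quotientMapₐ (relIdeal b c) (starR K ι) (relIdeal_le_comap b c)

/-- The tight universal `p`-algebra: the quotient of the free commutative associative algebra
without unit on the `x_i`, `x_i^*` (the polynomials without constant term) by the ideal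
`relIdeal`, realised as the non-unital subalgebra of the universal unital `p`-algebra that is
generated by the classes of the variables. -/
def Tp (b : Module.Basis ι K E) (c : Fin 4 → K) : NonUnitalSubalgebra K (Up b c) :=
  NonUnitalAlgebra.adjoin K (Set.range (gen b c))

theorem gen_mem_Tp (b : Module.Basis ι K E) (c : Fin 4 → K) (s : ι ⊕ ι) :
    gen b c s ∈ Tp b c :=
  NonUnitalAlgebra.subset_adjoin K ⟨s, rfl⟩

theorem starU_gen (b : Module.Basis ι K E) (c : Fin 4 → K) (s : ι ⊕ ι) :
    starU b c (gen b c s) = gen b c s.swap := by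
  simp [starU, gen, starR]

theorem starU_mem_Tp (b : Module.Basis ι K E) (c : Fin 4 → K) {z : Up b c} (hz : z ∈ Tp b c) :
    starU b c z ∈ Tp b c := by
  have h : Tp b c ≤ (Tp b c).comap (starU b c : Up b c →ₙₐ[K] Up b c) := by
    refine NonUnitalAlgebra.adjoin_le ?_
    rintro _ ⟨s, rfl⟩
    change starU b c (gen b c s) ∈ Tp b c
    rw [starU_gen]
    exact gen_mem_Tp b c _
  exact h hz

/-- The canonical involution of the tight universal `p`-algebra. -/
def starT (b : Module.Basis ι K E) (c : Fin 4 → K) (z : Tp b c) : Tp b c :=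
  ⟨starU b c z, starU_mem_Tp b c z.2⟩

/-- The universal representation `ρ : E → T_p`, `e_i ↦ x_i`. -/
def rho (b : Module.Basis ι K E) (c : Fin 4 → K) : E →ₗ[K] Tp b c :=
  b.constr K fun i => (⟨gen b c (Sum.inl i), gen_mem_Tp b c _⟩ : Tp b c)

end Representation

/-! ### The representing algebra of the automorphism group scheme -/

section AutScheme

variable {K : Type u} {E : Type v} {ι : Type w} [Field K] [NonUnitalNonAssocRing E] [Module K E]
  [Fintype ι] [DecidableEq ι]

/-- The generic matrix `(a_{ij})`; the variable `X none` stands for the inverse of its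
determinant. -/
def genMat (K : Type u) (ι : Type w) [Field K] :
    Matrix ι ι (MvPolynomial (Option (ι × ι)) K) :=
  Matrix.of fun i j => MvPolynomial.X (some (i, j))

/-- The coefficient at `e_m` of `f(e_i e_j) - f(e_i) f(e_j)`, where `f(e_j) = ∑ i, a_{ij} e_i`. -/
def multRel (b : Module.Basis ι K E) (i j m : ι) : MvPolynomial (Option (ι × ι)) K :=
  (∑ l, MvPolynomial.C (b.repr (b i * b j) l) * genMat K ι m l) -
    ∑ k, ∑ l, genMat K ι k i * genMat K ι l j * MvPolynomial.C (b.repr (b k * b l) m)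

/-- The ideal that says that the matrix is invertible and defines an algebra homomorphism. -/
def autIdeal (b : Module.Basis ι K E) : Ideal (MvPolynomial (Option (ι × ι)) K) :=
  Ideal.span ({MvPolynomial.X none * (genMat K ι).det - 1} ∪
    {f | ∃ i j m : ι, f = multRel b i j m})

/-- The algebra `ℋ = K[a_{ij}, 1/det] / (multiplicativity)` that represents the group scheme
`R ↦ Aut_R(R ⊗ E)`, see `hEquiv`; its Hopf structure is the one that the group law on the
right-hand side of `hEquiv` induces. -/
abbrev HAlg (b : Module.Basis ι K E) : Type (max u w) :=
  MvPolynomial (Option (ι × ι)) K ⧸ autIdeal b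

/-- The class of the matrix entry `a_{ij}` in `ℋ`. -/
def entry (b : Module.Basis ι K E) (i j : ι) : HAlg b :=
  Ideal.Quotient.mk (autIdeal b) (genMat K ι i j)

/-- The matrix over `R` that belongs to an `R`-valued point of `ℋ`. -/
def ptMat (b : Module.Basis ι K E) {R : Type*} [CommRing R] [Algebra K R] (φ : HAlg b →ₐ[K] R) :
    Matrix ι ι R :=
  Matrix.of fun i j => φ (entry b i j)

theorem ptMat_det_mul (b : Module.Basis ι K E) {R : Type*} [CommRing R] [Algebra K R]
    (φ : HAlg b →ₐ[K] R) :
    φ (Ideal.Quotient.mkₐ K (autIdeal b) (MvPolynomial.X none)) * (ptMat b φ).det = 1 := by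
  have h : Ideal.Quotient.mk (autIdeal b) (MvPolynomial.X none * (genMat K ι).det - 1) = 0 :=
    Ideal.Quotient.eq_zero_iff_mem.2 (Ideal.subset_span (Or.inl rfl))
  rw [map_sub, map_mul, map_one, sub_eq_zero] at h
  have h2 := congrArg φ h
  rw [map_mul, map_one] at h2
  have h3 : φ (Ideal.Quotient.mk (autIdeal b) (genMat K ι).det) = (ptMat b φ).det := by
    change ((φ : HAlg b →+* R).comp (Ideal.Quotient.mk (autIdeal b))) _ = _
    rw [RingHom.map_det]
    rfl
  rw [h3] at h2
  exact h2

theorem ptMat_det (b : Module.Basis ι K E) {R : Type*} [CommRing R] [Algebra K R]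
    (φ : HAlg b →ₐ[K] R) : IsUnit (ptMat b φ).det :=
  IsUnit.of_mul_eq_one_right _ (ptMat_det_mul b φ)

theorem ptMat_rel (b : Module.Basis ι K E) {R : Type*} [CommRing R] [Algebra K R]
    (φ : HAlg b →ₐ[K] R) (i j m : ι) :
    (∑ l, algebraMap K R (b.repr (b i * b j) l) * ptMat b φ m l) =
      ∑ k, ∑ l, ptMat b φ k i * ptMat b φ l j * algebraMap K R (b.repr (b k * b l) m) := by
  have h : φ (Ideal.Quotient.mkₐ K (autIdeal b) (multRel b i j m)) = 0 := by
    have : Ideal.Quotient.mkₐ K (autIdeal b) (multRel b i j m) = 0 :=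
      Ideal.Quotient.eq_zero_iff_mem.2 (Ideal.subset_span (Or.inr ⟨i, j, m, rfl⟩))
    rw [this, map_zero]
  have hC : ∀ a : K, φ (Ideal.Quotient.mkₐ K (autIdeal b) (MvPolynomial.C a)) =
      algebraMap K R a := by
    intro a
    rw [← MvPolynomial.algebraMap_eq, AlgHom.commutes, AlgHom.commutes]
  simp only [multRel, map_sub, map_sum, map_mul, hC] at h
  exact sub_eq_zero.1 h

variable [IsScalarTower K E E] [SMulCommClass K E E]

/-- A linear endomorphism of `R ⊗ E` with matrix `A` is multiplicative iff `A` satisfies the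
equations that define `ℋ`. -/
theorem mult_iff {R : Type*} [CommRing R] [Algebra K R] (b : Module.Basis ι K E)
    (A : Matrix ι ι R) (f : R ⊗[K] E →ₗ[R] R ⊗[K] E)
    (hf : ∀ j, f ((1 : R) ⊗ₜ[K] b j) = ∑ i, A i j ⊗ₜ[K] b i) :
    (∀ x y, f (x * y) = f x * f y) ↔
      ∀ i j m, (∑ l, algebraMap K R (b.repr (b i * b j) l) * A m l) =
        ∑ k, ∑ l, A k i * A l j * algebraMap K R (b.repr (b k * b l) m) := by
  have hL : ∀ i j m, (b.baseChange R).repr (f ((1 ⊗ₜ[K] b i) * (1 ⊗ₜ[K] b j))) m =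
      ∑ l, algebraMap K R (b.repr (b i * b j) l) * A m l := by
    intro i j m
    have h1 : ((1 : R) ⊗ₜ[K] b i) * ((1 : R) ⊗ₜ[K] b j) =
        ∑ l, algebraMap K R (b.repr (b i * b j) l) • ((1 : R) ⊗ₜ[K] b l) := by
      rw [Algebra.TensorProduct.tmul_mul_tmul, mul_one]
      conv_lhs => rw [← b.sum_repr (b i * b j)]
      rw [TensorProduct.tmul_sum]
      refine Finset.sum_congr rfl fun l _ => ?_
      rw [TensorProduct.tmul_smul, algebraMap_smul]
    have h2 : ∀ l, (b.baseChange R).repr (f (1 ⊗ₜ[K] b l)) m = A m l := by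
      intro l
      rw [hf, map_sum, Finsupp.finsetSum_apply]
      simp [Module.Basis.baseChange_repr_tmul, Finsupp.single_apply]
    rw [h1, map_sum, map_sum, Finsupp.finsetSum_apply]
    refine Finset.sum_congr rfl fun l _ => ?_
    rw [map_smul, map_smul, Finsupp.smul_apply, smul_eq_mul, h2]
  have hR : ∀ i j m, (b.baseChange R).repr (f (1 ⊗ₜ[K] b i) * f (1 ⊗ₜ[K] b j)) m =
      ∑ k, ∑ l, A k i * A l j * algebraMap K R (b.repr (b k * b l) m) := by
    intro i j m
    rw [hf, hf, Finset.sum_mul, map_sum, Finsupp.finsetSum_apply]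
    refine Finset.sum_congr rfl fun k _ => ?_
    rw [Finset.mul_sum, map_sum, Finsupp.finsetSum_apply]
    refine Finset.sum_congr rfl fun l _ => ?_
    rw [Algebra.TensorProduct.tmul_mul_tmul, Module.Basis.baseChange_repr_tmul, Algebra.smul_def,
      mul_comm]
  constructor
  · intro h i j m
    rw [← hL, ← hR, h]
  · intro h
    have key : (LinearMap.mul' R (R ⊗[K] E)).comp (TensorProduct.map f f) =
        f.comp (LinearMap.mul' R (R ⊗[K] E)) := by
      refine ((b.baseChange R).tensorProduct (b.baseChange R)).ext ?_
      rintro ⟨i, j⟩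
      apply (b.baseChange R).repr.injective
      ext m
      simp only [Module.Basis.tensorProduct_apply, LinearMap.comp_apply, TensorProduct.map_tmul,
        LinearMap.mul'_apply, Module.Basis.baseChange_apply]
      rw [hL, hR, h]
    intro x y
    exact (LinearMap.congr_fun key (x ⊗ₜ[R] y)).symm

/-- The automorphism of `R ⊗ E` that belongs to an `R`-valued point of `ℋ`:
`e_j ↦ ∑ i, φ(a_{ij}) e_i`. -/
def ptAut (b : Module.Basis ι K E) (R : Type*) [CommRing R] [Algebra K R]
    (φ : HAlg b →ₐ[K] R) : algAut R (R ⊗[K] E) :=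
  ⟨Matrix.toLinearEquiv (b.baseChange R) (ptMat b φ) (ptMat_det b φ), by
    refine (mult_iff b (ptMat b φ) (Matrix.toLin (b.baseChange R) (b.baseChange R) (ptMat b φ))
      ?_).2 (ptMat_rel b φ)
    intro j
    have := Matrix.toLin_self (b.baseChange R) (b.baseChange R) (ptMat b φ) j
    simpa [TensorProduct.smul_tmul'] using this⟩

theorem ptAut_apply (b : Module.Basis ι K E) (R : Type*) [CommRing R] [Algebra K R]
    (φ : HAlg b →ₐ[K] R) (j : ι) :
    (ptAut b R φ : R ⊗[K] E ≃ₗ[R] R ⊗[K] E) ((1 : R) ⊗ₜ[K] b j) =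
      ∑ i, φ (entry b i j) ⊗ₜ[K] b i := by
  have := Matrix.toLin_self (b.baseChange R) (b.baseChange R) (ptMat b φ) j
  rw [Module.Basis.baseChange_apply] at this
  refine Eq.trans this ?_
  simp [TensorProduct.smul_tmul', ptMat]

theorem ptAut_bijective (b : Module.Basis ι K E) (R : Type*) [CommRing R] [Algebra K R] :
    Function.Bijective (ptAut b R) := by
  constructor
  · intro φ ψ h
    have hM : ptMat b φ = ptMat b ψ := by
      have h1 := congrArg (fun g : algAut R (R ⊗[K] E) =>
        LinearMap.toMatrix (b.baseChange R) (b.baseChange R) (g : R ⊗[K] E ≃ₗ[R] R ⊗[K] E)) h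
      have h2 : ∀ φ : HAlg b →ₐ[K] R, LinearMap.toMatrix (b.baseChange R) (b.baseChange R)
          ((ptAut b R φ : R ⊗[K] E ≃ₗ[R] R ⊗[K] E) : R ⊗[K] E →ₗ[R] R ⊗[K] E) = ptMat b φ :=
        fun φ => LinearMap.toMatrix_toLin _ _ _
      simpa only [h2] using h1
    apply Ideal.Quotient.algHom_ext
    apply MvPolynomial.algHom_ext
    rintro (_ | ⟨i, j⟩)
    · have h1 := ptMat_det_mul b φ
      have h2 := ptMat_det_mul b ψ
      rw [← hM] at h2
      exact (ptMat_det b φ).mul_right_cancel (h1.trans h2.symm)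
    · exact congrFun (congrFun hM i) j
  · rintro ⟨g, hg⟩
    have hg' : ∀ x y, (g : R ⊗[K] E →ₗ[R] R ⊗[K] E) (x * y) =
      (g : R ⊗[K] E →ₗ[R] R ⊗[K] E) x * (g : R ⊗[K] E →ₗ[R] R ⊗[K] E) y := hg
    set A : Matrix ι ι R :=
      LinearMap.toMatrix (b.baseChange R) (b.baseChange R) (g : R ⊗[K] E →ₗ[R] R ⊗[K] E) with hA
    have hgA : ∀ j, (g : R ⊗[K] E →ₗ[R] R ⊗[K] E) ((1 : R) ⊗ₜ[K] b j) =
        ∑ i, A i j ⊗ₜ[K] b i := by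
      intro j
      have := Matrix.toLin_self (b.baseChange R) (b.baseChange R) A j
      rw [hA, Matrix.toLin_toMatrix] at this
      simpa [TensorProduct.smul_tmul'] using this
    have hrel := (mult_iff b A _ hgA).1 hg'
    have hdet : IsUnit A.det := LinearEquiv.isUnit_det g (b.baseChange R) (b.baseChange R)
    obtain ⟨t, ht⟩ := hdet.exists_left_inv
    let Φ : MvPolynomial (Option (ι × ι)) K →ₐ[K] R :=
      MvPolynomial.aeval fun o => o.elim t fun q => A q.1 q.2
    have hΦM : ∀ i j, Φ (genMat K ι i j) = A i j := by
      intro i j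
      simp [Φ, genMat]
    have hΦ : ∀ a ∈ autIdeal b, Φ a = 0 := by
      have : autIdeal b ≤ RingHom.ker (Φ : MvPolynomial (Option (ι × ι)) K →+* R) := by
        unfold autIdeal
        rw [Ideal.span_le]
        rintro f (rfl | ⟨i, j, m, rfl⟩)
        · change (Φ : MvPolynomial (Option (ι × ι)) K →+* R) _ = 0
          rw [map_sub, map_mul, map_one, RingHom.map_det, sub_eq_zero]
          have h1 : (Φ : MvPolynomial (Option (ι × ι)) K →+* R).mapMatrix (genMat K ι) = A := by
            ext i j
            exact hΦM i j
          rw [h1]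
          have h2 : (Φ : MvPolynomial (Option (ι × ι)) K →+* R) (MvPolynomial.X none) = t := by
            simp [Φ]
          rw [h2, ht]
        · change Φ _ = 0
          have hC : ∀ a : K, Φ (MvPolynomial.C a) = algebraMap K R a := by
            intro a
            rw [← MvPolynomial.algebraMap_eq, AlgHom.commutes]
          simp only [multRel, map_sub, map_sum, map_mul, hC, hΦM]
          exact sub_eq_zero.2 (hrel i j m)
      exact fun a ha => this ha
    refine ⟨Ideal.Quotient.liftₐ (autIdeal b) Φ hΦ, ?_⟩
    apply Subtype.ext
    apply LinearEquiv.toLinearMap_injective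
    refine (b.baseChange R).ext fun j => ?_
    rw [Module.Basis.baseChange_apply]
    refine (ptAut_apply b R _ j).trans ((hgA j).trans ?_).symm
    refine Finset.sum_congr rfl fun i _ => ?_
    congr 1
    exact (hΦM i j).symm

/-- `ℋ` represents the functor `R ↦ Aut_R(R ⊗ E)`.  The bijection sends `φ` to the automorphism
`e_j ↦ ∑ i, φ(a_{ij}) e_i` (see `ptAut_apply`); in particular it is natural in `R`. -/
def hEquiv (b : Module.Basis ι K E) (R : Type*) [CommRing R] [Algebra K R] :
    (HAlg b →ₐ[K] R) ≃ algAut R (R ⊗[K] E) :=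
  Equiv.ofBijective (ptAut b R) (ptAut_bijective b R)

end AutScheme

/-- `A ≅ K[x₁, …, xₙ] / (x₁^(q^e₁), …, xₙ^(q^eₙ))` for some `n ≥ 1` and exponents `eᵢ ≥ 1`. -/
def IsTruncPoly (K : Type u) (q : ℕ) (A : Type v) [Field K] [CommRing A] [Algebra K A] : Prop :=
  ∃ n : ℕ, 1 ≤ n ∧ ∃ e : Fin n → ℕ, (∀ i, 1 ≤ e i) ∧
    Nonempty (A ≃ₐ[K] (MvPolynomial (Fin n) K ⧸
      Ideal.span (Set.range fun i : Fin n =>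
        (MvPolynomial.X i : MvPolynomial (Fin n) K) ^ (q ^ e i))))

end EvoAlg

end

/-! Let χ be a homomorphism from `Tp` to a commutative algebra with χ(z*) = χ(z). The four terms of
p then merge, and r = χ ∘ ρ satisfies r(xy) = (λ₀+λ₁+λ₂+λ₃) r(x)r(y) (`hom_rho_mul`). Hence ker r is
an ideal with associative quotient, and r = 0 forces χ = 0, since the x_i and x_i* generate `Tp`. If
* is trivial, the inclusion of `Tp` into `Up` is such a χ; it is nonzero because ℋ has the counit.

An isomorphism `Tp` ≅ ℋ carries * to an automorphism of ℋ, which permutes the K-points. If there is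
only one K-point, it is therefore *-invariant (`point_starT`). If ℋ ≅ K, this point is injective and
* is trivial. If `algAut K E = ⊥`, it gives a nonzero r : E → K; for simple E its kernel is 0, so E
is associative.

There remains a perfect E over an algebraically closed K with trivial automorphism group.
Invertibility of the structure matrix makes distinct entries in a row of the generic automorphism
orthogonal (`entry_mul_entry`). The diagonal entries equal 1 at the only point, so they are units,
and the other entries vanish. Thus ℋ is the group algebra of M = ℤⁿ/(2ε_i - ε_j : ω_ji ≠ 0).
Perfectness gives M = 2M, so M is finite; a prime factor of |M| that is nonzero in K would give a
nontrivial character with values in K, hence a nontrivial automorphism. So M is trivial, which means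
ℋ ≅ K, or a q-group with q = char K, whose group algebra is a truncated polynomial algebra
(`nonempty_algEquiv_truncPoly`). -/

noncomputable section

namespace EvoAlg

/-! ### Homomorphisms from `Tp` that are invariant under the involution -/

section Representation

variable {K E ι : Type*} [Field K] [NonUnitalNonAssocRing E] [Module K E] [Fintype ι]

theorem rho_basis (b : Module.Basis ι K E) (c : Fin 4 → K) (i : ι) :
    rho b c (b i) = ⟨gen b c (Sum.inl i), gen_mem_Tp b c _⟩ :=
  b.constr_basis K _ i

/-- The defining relations of the universal unital `p`-algebra. -/
theorem gen_mul_gen {b : Module.Basis ι K E} (hb : IsNaturalBasis b) (c : Fin 4 → K) (i j : ι) :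
    c 0 • (gen b c (Sum.inl i) * gen b c (Sum.inl j)) +
      c 1 • (gen b c (Sum.inl i) * gen b c (Sum.inr j)) +
      c 2 • (gen b c (Sum.inr i) * gen b c (Sum.inl j)) +
      c 3 • (gen b c (Sum.inr i) * gen b c (Sum.inr j)) =
    ∑ l, b.repr (b i * b j) l • gen b c (Sum.inl l) := by
  have hmem : pProd c (starR K ι) (MvPolynomial.X (Sum.inl i)) (MvPolynomial.X (Sum.inl j)) -
      ∑ l, MvPolynomial.C (b.repr (b i * b j) l) * MvPolynomial.X (Sum.inl l) ∈
        relIdeal b c := by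
    refine Ideal.subset_span (Or.inl ?_)
    -- Both kinds of relation have this one form, because b_i b_j = 0 makes the sum vanish for i ≠
    -- j.
    by_cases hij : i = j
    · subst hij
      exact Or.inr ⟨i, rfl⟩
    · refine Or.inl ⟨i, j, hij, ?_⟩
      simp [hb i j hij]
  have h : Ideal.Quotient.mkₐ K (relIdeal b c) _ = 0 := Ideal.Quotient.eq_zero_iff_mem.2 hmem
  rw [map_sub, sub_eq_zero] at h
  simp only [pProd, starR, MvPolynomial.rename_X, Sum.swap_inl, map_add, map_smul, map_mul,
    map_sum, ← MvPolynomial.smul_eq_C_mul] at h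
  exact h

theorem starT_gen (b : Module.Basis ι K E) (c : Fin 4 → K) (s : ι ⊕ ι) :
    starT b c ⟨gen b c s, gen_mem_Tp b c s⟩ = ⟨gen b c s.swap, gen_mem_Tp b c s.swap⟩ :=
  Subtype.ext (starU_gen b c s)

/-- The involution of the tight universal `p`-algebra as an algebra homomorphism. -/
def starHom (b : Module.Basis ι K E) (c : Fin 4 → K) : Tp b c →ₙₐ[K] Tp b c where
  toFun := starT b c
  map_smul' a z := Subtype.ext (map_smul (starU b c) a (z : Up b c))
  map_zero' := Subtype.ext (map_zero (starU b c))
  map_add' z w := Subtype.ext (map_add (starU b c) (z : Up b c) w)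
  map_mul' z w := Subtype.ext (map_mul (starU b c) (z : Up b c) w)

set_option synthInstance.maxHeartbeats 200000 in
/-- A homomorphism from `T_p` that vanishes on the generators is zero. -/
theorem hom_eq_zero_of_gen {b : Module.Basis ι K E} {c : Fin 4 → K} {A : Type*} [CommRing A]
    [Algebra K A] (χ : Tp b c →ₙₐ[K] A)
    (h : ∀ s, χ ⟨gen b c s, gen_mem_Tp b c s⟩ = 0) (z : Tp b c) : χ z = 0 := by
  obtain ⟨z, hz⟩ := z
  induction hz using NonUnitalAlgebra.adjoin_induction with
  | mem x hx =>
    obtain ⟨s, rfl⟩ := hx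
    exact h s
  | add x y hx hy h1 h2 =>
    rw [← add_zero (0 : A)]
    nth_rw 1 [← h1]
    rw [← h2, ← map_add]
    rfl
  | zero => exact map_zero χ
  | mul x y hx hy h1 h2 =>
    rw [← mul_zero (0 : A)]
    nth_rw 1 [← h1]
    rw [← h2, ← map_mul]
    rfl
  | smul a x hx h1 =>
    rw [← smul_zero a, ← h1, ← map_smul]
    rfl

variable {b : Module.Basis ι K E} {c : Fin 4 → K} {A : Type*} [CommRing A] [Algebra K A]

/-- A homomorphism from `T_p` that is invariant under the involution kills `T_p` as soon as it
kills the image of `ρ`. -/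
theorem hom_eq_zero_of_rho (χ : Tp b c →ₙₐ[K] A) (hχ : ∀ z, χ (starT b c z) = χ z)
    (h : ∀ x, χ (rho b c x) = 0) (z : Tp b c) : χ z = 0 := by
  have h1 : ∀ i, χ ⟨gen b c (Sum.inl i), gen_mem_Tp b c _⟩ = 0 := fun i => by
    rw [← rho_basis, h]
  refine hom_eq_zero_of_gen χ ?_ z
  rintro (i | i)
  · exact h1 i
  · have := hχ ⟨gen b c (Sum.inl i), gen_mem_Tp b c _⟩
    rw [starT_gen, h1] at this
    exact this

set_option synthInstance.maxHeartbeats 200000 in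
/-- A homomorphism from `T_p` that is invariant under the involution turns the multiplication
of `E` into a multiple of that of the target. -/
theorem hom_rho_mul [IsScalarTower K E E] [SMulCommClass K E E] (hb : IsNaturalBasis b)
    (χ : Tp b c →ₙₐ[K] A)
    (hχ : ∀ z, χ (starT b c z) = χ z) (x y : E) :
    χ (rho b c (x * y)) =
      (c 0 + c 1 + c 2 + c 3) • (χ (rho b c x) * χ (rho b c y)) := by
  have hs : ∀ i, χ ⟨gen b c (Sum.inr i), gen_mem_Tp b c _⟩ = χ (rho b c (b i)) := fun i => by
    have := hχ ⟨gen b c (Sum.inl i), gen_mem_Tp b c _⟩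
    rw [starT_gen] at this
    rw [rho_basis]
    exact this
  let r : E →ₗ[K] A := (χ : Tp b c →ₗ[K] A).comp (rho b c)
  have hr : (LinearMap.mul K E).compr₂ r =
      (c 0 + c 1 + c 2 + c 3) • (LinearMap.mul K A).compl₁₂ r r := by
    refine LinearMap.ext_basis b b fun i j => ?_
    let g : ι ⊕ ι → Tp b c := fun s => ⟨gen b c s, gen_mem_Tp b c s⟩
    have h : c 0 • (g (Sum.inl i) * g (Sum.inl j)) + c 1 • (g (Sum.inl i) * g (Sum.inr j)) +
        c 2 • (g (Sum.inr i) * g (Sum.inl j)) + c 3 • (g (Sum.inr i) * g (Sum.inr j)) =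
        rho b c (b i * b j) := by
      apply Subtype.ext
      conv_rhs => rw [← b.sum_repr (b i * b j), map_sum]
      simp only [map_smul, rho_basis, AddSubmonoidClass.coe_finsetSum]
      exact gen_mul_gen hb c i j
    have h1 := congrArg χ h
    simp only [map_add, map_smul, map_mul] at h1
    have hl : ∀ i, χ (g (Sum.inl i)) = χ (rho b c (b i)) := fun i => by rw [rho_basis]
    have hrr : ∀ i, χ (g (Sum.inr i)) = χ (rho b c (b i)) := hs
    -- Invariance identifies the images of x_i and x_i*, so all four products coincide and only the
    -- sum of the coefficients matters.
    rw [hl, hl, hrr, hrr] at h1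
    simp only [LinearMap.compr₂_apply, LinearMap.mul_apply', LinearMap.smul_apply,
      LinearMap.compl₁₂_apply]
    change χ (rho b c (b i * b j)) = _ • (χ (rho b c (b i)) * χ (rho b c (b j)))
    rw [← h1, add_smul, add_smul, add_smul]
  exact LinearMap.congr_fun₂ hr x y

end Representation

/-! ### Linear maps that are multiplicative up to a scalar -/

section ScaledHom

variable {K E A : Type*} [Field K] [NonUnitalNonAssocRing E] [Module K E] [CommRing A]
  [Algebra K A] {r : E →ₗ[K] A} {a : K}

/-- Both bracketings expand to a² r(x)r(y)r(z) in the associative target. -/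
theorem map_assoc_of_map_mul (h : ∀ x y, r (x * y) = a • (r x * r y)) (x y z : E) :
    r (x * y * z) = r (x * (y * z)) := by
  simp only [h, mul_smul_comm, smul_mul_assoc, mul_assoc]

theorem exists_twoSidedIdeal_of_map_mul (h : ∀ x y, r (x * y) = a • (r x * r y)) :
    ∃ J : TwoSidedIdeal E, (J : Set E) = (LinearMap.ker r : Set E) ∧
      IsAssoc J.ringCon.Quotient := by
  let J : TwoSidedIdeal E := TwoSidedIdeal.mk' (LinearMap.ker r) (zero_mem _)
    (fun h1 h2 => add_mem h1 h2) (fun h1 => neg_mem h1)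
    (fun {x y} hy => by
      have hy' : r y = 0 := hy
      change r (x * y) = 0
      rw [h, hy', mul_zero, smul_zero])
    (fun {x y} hx => by
      have hx' : r x = 0 := hx
      change r (x * y) = 0
      rw [h, hx', zero_mul, smul_zero])
  have hJ : (J : Set E) = LinearMap.ker r := TwoSidedIdeal.coe_mk' _ _ _ _ _ _
  refine ⟨J, hJ, fun x y z => ?_⟩
  induction x using Quotient.inductionOn with | _ x
  induction y using Quotient.inductionOn with | _ y
  induction z using Quotient.inductionOn with | _ z
  refine Quotient.sound' ?_
  change J.ringCon (x * y * z) (x * (y * z))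
  rw [TwoSidedIdeal.rel_iff, ← SetLike.mem_coe, hJ]
  change r _ = 0
  rw [map_sub, map_assoc_of_map_mul h, sub_self]

theorem isAssoc_of_map_mul (h : ∀ x y, r (x * y) = a • (r x * r y)) (hr : Function.Injective r) :
    IsAssoc E :=
  fun x y z => hr (map_assoc_of_map_mul h x y z)

theorem injective_of_isSimpleAlg (hE : IsSimpleAlg K E)
    (h : ∀ x y, r (x * y) = a • (r x * r y)) (hr : r ≠ 0) : Function.Injective r := by
  have hJ : ∀ x : E, ∀ y ∈ LinearMap.ker r, x * y ∈ LinearMap.ker r ∧ y * x ∈ LinearMap.ker r := by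
    intro x y hy
    rw [LinearMap.mem_ker] at hy
    simp [h, hy]
  rcases hE.2 _ hJ with h0 | h1
  · exact LinearMap.ker_eq_bot.1 h0
  · exact absurd (LinearMap.ker_eq_top.1 h1) hr

end ScaledHom

end EvoAlg

end

noncomputable section

namespace EvoAlg

/-! ### The K-points of ℋ -/

section AutScheme

variable {K E ι : Type*} [Field K] [NonUnitalNonAssocRing E] [Module K E]
  [Fintype ι] [DecidableEq ι] {b : Module.Basis ι K E}

/-- The remaining generator is the inverse of the determinant, so the entries determine its image.
-/
theorem HAlg.algHom_ext {R : Type*} [CommRing R] [Algebra K R] {φ ψ : HAlg b →ₐ[K] R}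
    (h : ∀ i j, φ (entry b i j) = ψ (entry b i j)) : φ = ψ := by
  have hM : ptMat b φ = ptMat b ψ := Matrix.ext h
  apply Ideal.Quotient.algHom_ext
  apply MvPolynomial.algHom_ext
  rintro (_ | ⟨i, j⟩)
  · have h1 := ptMat_det_mul b φ
    have h2 := ptMat_det_mul b ψ
    rw [← hM] at h2
    exact (ptMat_det b φ).mul_right_cancel (h1.trans h2.symm)
  · exact h i j

variable [IsScalarTower K E E] [SMulCommClass K E E]

theorem lid_mul (x y : K ⊗[K] E) :
    TensorProduct.lid K E (x * y) = TensorProduct.lid K E x * TensorProduct.lid K E y := by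
  induction x with
  | zero => simp
  | add x x' h h' => rw [add_mul, map_add, map_add, add_mul, h, h']
  | tmul a x =>
    induction y with
    | zero => simp
    | add y y' h h' => rw [mul_add, map_add, map_add, mul_add, h, h']
    | tmul a' y =>
      rw [Algebra.TensorProduct.tmul_mul_tmul]
      simp only [TensorProduct.lid_tmul, smul_mul_assoc, mul_smul_comm, mul_smul]
      exact smul_comm a a' (x * y)

/-- If `E` has only the trivial automorphism, then the identity is the only `K`-point. -/
theorem apply_entry_of_algAut_eq_bot (h : algAut K E = ⊥) (φ : HAlg b →ₐ[K] K) (i j : ι) :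
    φ (entry b i j) = if i = j then 1 else 0 := by
  let g : K ⊗[K] E ≃ₗ[K] K ⊗[K] E := (ptAut b K φ : K ⊗[K] E ≃ₗ[K] K ⊗[K] E)
  have hg : ∀ x y, g (x * y) = g x * g y := (ptAut b K φ).2
  let e := TensorProduct.lid K E
  let g' : E ≃ₗ[K] E := (e.symm.trans g).trans e
  have hes : ∀ x y : E, e.symm (x * y) = e.symm x * e.symm y := fun x y => by
    apply e.injective
    rw [e.apply_symm_apply, lid_mul]
    exact (congrArg₂ _ (e.apply_symm_apply x) (e.apply_symm_apply y)).symm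
  have hg' : g' ∈ algAut K E := by
    intro x y
    change e (g (e.symm (x * y))) = e (g (e.symm x)) * e (g (e.symm y))
    rw [hes, hg, lid_mul]
  rw [h, Subgroup.mem_bot] at hg'
  have h1 : e (g (e.symm (b j))) = b j := LinearEquiv.congr_fun hg' (b j)
  have h2 : g (e.symm (b j)) = ∑ i, φ (entry b i j) ⊗ₜ[K] b i := by
    rw [TensorProduct.lid_symm_apply]
    exact ptAut_apply b K φ j
  rw [h2, map_sum] at h1
  simp only [e, TensorProduct.lid_tmul] at h1
  have h3 := congrArg (fun x => b.repr x i) h1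
  simpa [Finsupp.single_apply, eq_comm] using h3

theorem subsingleton_algHom_of_algAut_eq_bot (h : algAut K E = ⊥) (φ ψ : HAlg b →ₐ[K] K) :
    φ = ψ :=
  HAlg.algHom_ext fun i j => by
    rw [apply_entry_of_algAut_eq_bot h, apply_entry_of_algAut_eq_bot h]

variable (b) in
/-- The identity automorphism as a `K`-point. -/
def counitH : HAlg b →ₐ[K] K := (hEquiv b K).symm 1

/-- The identity automorphism is a point, so ℋ maps to a field; this is what makes `Tp` nonzero. -/
instance : Nontrivial (HAlg b) := (counitH b).toRingHom.domain_nontrivial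

end AutScheme

section NonUnitalPoints

variable {K H : Type*} [Field K] [CommRing H] [Algebra K H]

/-- A nonzero multiplicative linear form on a unital algebra is unital. -/
theorem map_one_of_ne_zero (g : H →ₙₐ[K] K) (hg : ∃ z, g z ≠ 0) : g 1 = 1 := by
  obtain ⟨z, hz⟩ := hg
  have : g 1 * g z = 1 * g z := by rw [← map_mul, one_mul, one_mul]
  exact mul_right_cancel₀ hz this

/-- A nonzero multiplicative linear form as a homomorphism of unital algebras. -/
def algHomOfNeZero (g : H →ₙₐ[K] K) (hg : ∃ z, g z ≠ 0) : H →ₐ[K] K where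
  toFun := g
  map_one' := map_one_of_ne_zero g hg
  map_mul' := map_mul g
  map_zero' := map_zero g
  map_add' := map_add g
  commutes' a := by
    rw [Algebra.algebraMap_eq_smul_one, map_smul, map_one_of_ne_zero g hg]
    simp

end NonUnitalPoints

/-! ### Transport of the involution to ℋ -/

section Main

variable {K E ι : Type*} [Field K] [NonUnitalNonAssocRing E] [Module K E]
  [Fintype ι] [DecidableEq ι] {b : Module.Basis ι K E} {c : Fin 4 → K}

omit [DecidableEq ι] in
theorem starT_starT (z : Tp b c) : starT b c (starT b c z) = z := by
  refine Subtype.ext ?_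
  change starU b c (starU b c z) = z
  obtain ⟨f, hf⟩ := Ideal.Quotient.mk_surjective (z : Up b c)
  rw [← hf]
  change Ideal.Quotient.mk _ (starR K ι (starR K ι f)) = _
  rw [starR_starR]

/-- If two points of `ℋ ≅ T_p` always agree, they are invariant under the involution. -/
theorem point_starT {f : Tp b c →ₙₐ[K] HAlg b} (hf : Function.Bijective f)
    (hsub : ∀ φ ψ : HAlg b →ₐ[K] K, φ = ψ) (φ : HAlg b →ₐ[K] K) (z : Tp b c) :
    φ (f (starT b c z)) = φ (f z) := by
  let finv : HAlg b →ₙₐ[K] Tp b c :=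
    NonUnitalAlgHom.inverse f (Function.invFun f) (Function.leftInverse_invFun hf.1)
      (Function.rightInverse_invFun hf.2)
  have hfinv : ∀ z, finv (f z) = z := Function.leftInverse_invFun hf.1
  let g : HAlg b →ₙₐ[K] K :=
    ((φ : HAlg b →ₙₐ[K] K).comp f).comp ((starHom b c).comp finv)
  have hgf : ∀ z, g (f z) = φ (f (starT b c z)) := fun z => by
    change φ (f (starT b c (finv (f z)))) = _
    rw [hfinv]
  -- The composite is only known to be non-unital. A nonzero value suffices for unitality, and the
  -- star of the preimage of 1 supplies one.
  have hg : ∃ z, g z ≠ 0 := by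
    obtain ⟨u, hu⟩ := hf.2 1
    refine ⟨f (starT b c u), ?_⟩
    rw [hgf, starT_starT, hu, map_one]
    exact one_ne_zero
  rw [← hgf]
  exact DFunLike.congr_fun (hsub (algHomOfNeZero g hg) φ) (f z)

/-- If `ℋ` is one-dimensional, then the involution is trivial. -/
theorem starT_eq_of_algEquiv {f : Tp b c →ₙₐ[K] HAlg b} (hf : Function.Bijective f)
    (e : HAlg b ≃ₐ[K] K) (z : Tp b c) : starT b c z = z := by
  apply hf.1
  apply e.injective
  refine point_starT hf (fun φ ψ => ?_) (e : HAlg b →ₐ[K] K) z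
  refine AlgHom.ext fun x => ?_
  obtain ⟨a, rfl⟩ := e.symm.surjective x
  have : e.symm a = algebraMap K _ a := e.symm.commutes a
  rw [this, φ.commutes, ψ.commutes]

variable [IsScalarTower K E E] [SMulCommClass K E E]

theorem exists_ne_zero_of_bijective {f : Tp b c →ₙₐ[K] HAlg b} (hf : Function.Bijective f) :
    ∃ z : Tp b c, z ≠ 0 := by
  obtain ⟨u, hu⟩ := hf.2 1
  refine ⟨u, fun h => ?_⟩
  rw [h, map_zero] at hu
  exact zero_ne_one hu

/-- A simple evolution algebra that is not associative has a nontrivial automorphism. -/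
theorem algAut_ne_bot_of_isSimpleAlg (hb : IsNaturalBasis b) {f : Tp b c →ₙₐ[K] HAlg b}
    (hf : Function.Bijective f) (hE : IsSimpleAlg K E) (hE' : ¬ IsAssoc E) :
    algAut K E ≠ ⊥ := by
  intro h
  let χ : Tp b c →ₙₐ[K] K := (counitH b : HAlg b →ₙₐ[K] K).comp f
  have hχ : ∀ z, χ (starT b c z) = χ z :=
    point_starT hf (subsingleton_algHom_of_algAut_eq_bot h) (counitH b)
  let r : E →ₗ[K] K := (χ : Tp b c →ₗ[K] K).comp (rho b c)
  have hmul : ∀ x y, r (x * y) = (c 0 + c 1 + c 2 + c 3) • (r x * r y) := hom_rho_mul hb χ hχ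
  refine hE' (isAssoc_of_map_mul hmul (injective_of_isSimpleAlg hE hmul fun h0 => ?_))
  obtain ⟨u, hu⟩ := hf.2 1
  have h1 := hom_eq_zero_of_rho χ hχ (LinearMap.congr_fun h0) u
  change counitH b (f u) = 0 at h1
  rw [hu, map_one] at h1
  exact one_ne_zero h1

/-- If the involution is trivial, then `E / ker ρ` is a nonzero associative algebra. -/
theorem ker_rho_of_starT_eq (hb : IsNaturalBasis b) {f : Tp b c →ₙₐ[K] HAlg b}
    (hf : Function.Bijective f) (hs : ∀ z : Tp b c, starT b c z = z) :
    (¬ IsAssoc E → ¬ Function.Injective (rho b c)) ∧ LinearMap.ker (rho b c) ≠ ⊤ ∧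
      ∃ J : TwoSidedIdeal E, (J : Set E) = (LinearMap.ker (rho b c) : Set E) ∧
        IsAssoc J.ringCon.Quotient := by
  -- The inclusion is injective, so passing to the unital commutative target does not change the
  -- kernel.
  let χ : Tp b c →ₙₐ[K] Up b c := NonUnitalSubalgebraClass.subtype (Tp b c)
  have hχ : ∀ z, χ (starT b c z) = χ z := fun z => by rw [hs]
  let r : E →ₗ[K] Up b c := (χ : Tp b c →ₗ[K] Up b c).comp (rho b c)
  have hmul : ∀ x y, r (x * y) = (c 0 + c 1 + c 2 + c 3) • (r x * r y) := hom_rho_mul hb χ hχ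
  have hker : LinearMap.ker r = LinearMap.ker (rho b c) :=
    Submodule.ext fun x => ⟨fun h => Subtype.ext h, fun h => congrArg Subtype.val h⟩
  refine ⟨fun hE hinj => hE (isAssoc_of_map_mul hmul (Subtype.val_injective.comp hinj)), ?_, ?_⟩
  · intro htop
    rw [← hker, LinearMap.ker_eq_top] at htop
    obtain ⟨z, hz⟩ := exists_ne_zero_of_bijective hf
    exact hz (Subtype.ext (hom_eq_zero_of_rho χ hχ (LinearMap.congr_fun htop) z))
  · rw [← hker]
    exact exists_twoSidedIdeal_of_map_mul hmul

end Main

end EvoAlg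

end

noncomputable section

namespace EvoAlg

/-! ### Group algebras of finite q-groups in characteristic q -/

section Zmod

/-- The homomorphism from `ℤ/n` to the units that is given by a unit `u` with `u ^ n = 1`. -/
def zmodUnitHom {A : Type*} [CommRing A] (n : ℕ) (u : Aˣ) (h : u ^ n = 1) :
    ZMod n →+ Additive Aˣ :=
  ZMod.lift n ⟨zmultiplesHom _ (Additive.ofMul u), by
    rw [zmultiplesHom_apply, natCast_zsmul, ← ofMul_pow, h, ofMul_one]⟩

theorem zmodUnitHom_one {A : Type*} [CommRing A] (n : ℕ) (u : Aˣ) (h : u ^ n = 1) :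
    zmodUnitHom n u h 1 = Additive.ofMul u := by
  have := ZMod.lift_coe n (A := Additive Aˣ) ⟨zmultiplesHom _ (Additive.ofMul u), by
    rw [zmultiplesHom_apply, natCast_zsmul, ← ofMul_pow, h, ofMul_one]⟩ 1
  rw [Int.cast_one] at this
  refine this.trans ?_
  simp

theorem zmod_hom_ext {n : ℕ} {G : Type*} [AddCommGroup G] {f g : ZMod n →+ G}
    (h : f 1 = g 1) : f = g := by
  refine AddMonoidHom.ext fun y => ?_
  obtain ⟨k, rfl⟩ := ZMod.intCast_surjective y
  rw [← zsmul_one, map_zsmul, map_zsmul, h]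

end Zmod

section Truncated

universe u v

variable {K : Type u} [Field K] (q : ℕ)

/-- The truncated polynomial algebra. -/
abbrev TruncPoly (K : Type u) [Field K] (q : ℕ) {m : ℕ} (r : Fin m → ℕ) : Type u :=
  MvPolynomial (Fin m) K ⧸ Ideal.span (Set.range fun i : Fin m =>
    (MvPolynomial.X i : MvPolynomial (Fin m) K) ^ (q ^ r i))

/-- The iterated Frobenius is additive and kills x_i, so 1 + x_i has the order needed for the image
of a generator of ℤ/q^{r_i}. -/
theorem one_add_X_pow [Fact q.Prime] [CharP K q] {m : ℕ} (r : Fin m → ℕ) (i : Fin m) :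
    (Ideal.Quotient.mk _ (1 + MvPolynomial.X i) : TruncPoly K q r) ^ (q ^ r i) = 1 := by
  rw [← map_pow, add_pow_char_pow, one_pow, map_add, map_one]
  have h : (Ideal.Quotient.mk _ (MvPolynomial.X i ^ q ^ r i) : TruncPoly K q r) = 0 :=
    Ideal.Quotient.eq_zero_iff_mem.2 (Ideal.subset_span ⟨i, rfl⟩)
  rw [h, add_zero]

/-- The unit `1 + x_i` of the truncated polynomial algebra. -/
def truncUnit [Fact q.Prime] [CharP K q] {m : ℕ} (r : Fin m → ℕ) (i : Fin m) :
    (TruncPoly K q r)ˣ :=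
  Units.ofPowEqOne _ _ (one_add_X_pow q r i) (pow_ne_zero _ (Fact.out : q.Prime).ne_zero)

theorem truncUnit_val [Fact q.Prime] [CharP K q] {m : ℕ} (r : Fin m → ℕ) (i : Fin m) :
    (truncUnit (K := K) q r i : TruncPoly K q r) =
      Ideal.Quotient.mk _ (1 + MvPolynomial.X i) := rfl

theorem truncUnit_pow [Fact q.Prime] [CharP K q] {m : ℕ} (r : Fin m → ℕ) (i : Fin m) :
    truncUnit (K := K) q r i ^ (q ^ r i) = 1 :=
  Units.ext (by rw [Units.val_pow_eq_pow_val, truncUnit_val, one_add_X_pow, Units.val_one])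

/-- An algebra with the universal property of the group algebra of `∏ ℤ/q^{r_i}` is, in
characteristic `q`, a truncated polynomial algebra. -/
theorem nonempty_algEquiv_truncPoly [Fact q.Prime] [CharP K q] {H : Type v} [CommRing H]
    [Algebra K H] [Nontrivial H] {M : Type*} [AddCommGroup M] (ψ : M →+ Additive Hˣ)
    (lift : ∀ (A : Type u) [CommRing A] [Algebra K A] (χ : M →+ Additive Aˣ),
      ∃ F : H →ₐ[K] A, ∀ x, F ((ψ x).toMul : Hˣ) = ((χ x).toMul : Aˣ))
    (ext : ∀ F F' : H →ₐ[K] H, (∀ x, F ((ψ x).toMul : Hˣ) = F' ((ψ x).toMul : Hˣ)) → F = F')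
    {m : ℕ} (r : Fin m → ℕ) (e : M ≃+ DirectSum (Fin m) fun i => ZMod (q ^ r i)) :
    Nonempty (H ≃ₐ[K] TruncPoly K q r) := by
  have : CharP H q := charP_of_injective_algebraMap (algebraMap K H).injective q
  -- The generators of the cyclic summands. The isomorphism `F` sends the group element d_i to 1 +
  -- x_i, and its inverse `G` sends x_i to ψ(d_i) - 1.
  let d : Fin m → M := fun i => e.symm (DirectSum.of (fun i => ZMod (q ^ r i)) i 1)
  let χ₀ : (DirectSum (Fin m) fun i => ZMod (q ^ r i)) →+ Additive (TruncPoly K q r)ˣ :=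
    DirectSum.toAddMonoid (β := fun i => ZMod (q ^ r i)) (γ := Additive (TruncPoly K q r)ˣ)
      fun i => zmodUnitHom _ _ (truncUnit_pow q r i)
  have hχ₀ : ∀ i, χ₀ (DirectSum.of (fun i => ZMod (q ^ r i)) i 1) =
      Additive.ofMul (truncUnit q r i) := fun i => by
    rw [DirectSum.toAddMonoid_of, zmodUnitHom_one]
  let χ : M →+ Additive (TruncPoly K q r)ˣ := χ₀.comp e.toAddMonoidHom
  have hχ : ∀ i, χ (d i) = Additive.ofMul (truncUnit q r i) := fun i => by
    rw [← hχ₀]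
    exact congrArg χ₀ (e.apply_symm_apply _)
  obtain ⟨F, hF⟩ := lift _ χ
  have hd : ∀ i, (((ψ (d i)).toMul : Hˣ) : H) ^ (q ^ r i) = 1 := fun i => by
    have h1 : (q ^ r i) • d i = 0 := by
      rw [← map_nsmul, ← map_nsmul, nsmul_one, ZMod.natCast_self, map_zero, map_zero]
    rw [← Units.val_pow_eq_pow_val, ← toMul_nsmul, ← map_nsmul, h1, map_zero]
    rfl
  let G₀ : MvPolynomial (Fin m) K →ₐ[K] H :=
    MvPolynomial.aeval fun i => (((ψ (d i)).toMul : Hˣ) : H) - 1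
  have hG₀ : Ideal.span (Set.range fun i : Fin m =>
      (MvPolynomial.X i : MvPolynomial (Fin m) K) ^ (q ^ r i)) ≤ RingHom.ker G₀ := by
    rw [Ideal.span_le]
    rintro _ ⟨i, rfl⟩
    change G₀ _ = 0
    rw [map_pow, MvPolynomial.aeval_X, sub_pow_char_pow, hd, one_pow, sub_self]
  let G : TruncPoly K q r →ₐ[K] H := Ideal.Quotient.liftₐ _ G₀ fun a ha => hG₀ ha
  have hG : ∀ i, G (truncUnit (K := K) q r i) = ((ψ (d i)).toMul : Hˣ) := fun i => by
    change G₀ (1 + MvPolynomial.X i) = _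
    rw [map_add, map_one, MvPolynomial.aeval_X, add_sub_cancel]
  have hGχ : (MonoidHom.toAdditive (Units.map (G : TruncPoly K q r →* H))).comp χ₀ =
      ψ.comp e.symm.toAddMonoidHom := by
    refine DirectSum.addHom_ext' fun i => zmod_hom_ext ?_
    simp only [AddMonoidHom.comp_apply, hχ₀]
    exact congrArg Additive.ofMul (Units.ext (hG i))
  refine ⟨AlgEquiv.ofAlgHom F G ?_ ?_⟩
  · apply Ideal.Quotient.algHom_ext
    apply MvPolynomial.algHom_ext
    intro i
    change F (G₀ (MvPolynomial.X i)) = Ideal.Quotient.mk _ (MvPolynomial.X i)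
    rw [MvPolynomial.aeval_X, map_sub, map_one, hF, hχ]
    change (Ideal.Quotient.mk _ (1 + MvPolynomial.X i) : TruncPoly K q r) - 1 = _
    rw [map_add, map_one, add_sub_cancel_left]
  · refine ext _ _ fun x => ?_
    change G (F _) = _
    rw [hF]
    have h1 := DFunLike.congr_fun hGχ (e x)
    have h2 := congrArg (fun a : Additive Hˣ => ((a.toMul : Hˣ) : H)) h1
    refine h2.trans ?_
    change (((ψ (e.symm (e x))).toMul : Hˣ) : H) = _
    rw [e.symm_apply_apply]
    rfl

end Truncated

/-! ### Units and the Nullstellensatz -/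

section Points

/-- Over an algebraically closed field, an element of a finitely generated algebra is a unit as
soon as it does not vanish at any point. -/
theorem isUnit_of_forall_algHom_ne_zero {K H : Type*} [Field K] [IsAlgClosed K] [CommRing H]
    [Algebra K H] [Algebra.FiniteType K H] (x : H) (hx : ∀ φ : H →ₐ[K] K, φ x ≠ 0) :
    IsUnit x := by
  by_contra hu
  obtain ⟨m, hm, hxm⟩ := exists_max_ideal_of_mem_nonunits hu
  let _ := Ideal.Quotient.field m
  -- The residue field is finite over K, hence equal to K, so the maximal ideal is a point at which
  -- x vanishes.
  have : Module.Finite K (H ⧸ m) := finite_of_finite_type_of_isJacobsonRing K (H ⧸ m)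
  let e : K ≃ₐ[K] H ⧸ m := AlgEquiv.ofBijective (Algebra.ofId K (H ⧸ m))
    IsAlgClosed.algebraMap_bijective_of_isIntegral
  refine hx ((e.symm : (H ⧸ m) →ₐ[K] K).comp (Ideal.Quotient.mkₐ K m)) ?_
  change e.symm (Ideal.Quotient.mk m x) = 0
  rw [Ideal.Quotient.eq_zero_iff_mem.2 hxm, map_zero]

end Points

end EvoAlg

end

noncomputable section

namespace EvoAlg

/-! ### The character group of the diagonal automorphisms -/

section CharGroup

variable {K E ι : Type*} [Field K] [NonUnitalNonAssocRing E] [Module K E]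

/-- The relations `2 ε_i = ε_j` for `ω_{ji} ≠ 0`. -/
def charRel (b : Module.Basis ι K E) : Submodule ℤ (ι →₀ ℤ) :=
  Submodule.span ℤ {x | ∃ i j, b.repr (b i * b i) j ≠ 0 ∧
    x = (2 : ℤ) • Finsupp.single i 1 - Finsupp.single j 1}

/-- The character group of the group of diagonal automorphisms. -/
abbrev CharGroup (b : Module.Basis ι K E) := (ι →₀ ℤ) ⧸ charRel b

/-- The character of the `i`-th diagonal entry. -/
def weight (b : Module.Basis ι K E) (i : ι) : CharGroup b :=
  (charRel b).mkQ (Finsupp.single i 1)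

variable {b : Module.Basis ι K E}

theorem two_nsmul_weight {i j : ι} (h : b.repr (b i * b i) j ≠ 0) :
    2 • weight b i = weight b j := by
  have h1 : (charRel b).mkQ ((2 : ℤ) • Finsupp.single i 1 - Finsupp.single j 1) = 0 :=
    (Submodule.Quotient.mk_eq_zero _).2 (Submodule.subset_span ⟨i, j, h, rfl⟩)
  rw [map_sub, map_smul, sub_eq_zero, ofNat_zsmul] at h1
  exact h1

theorem charGroup_hom_ext {G : Type*} [AddCommGroup G] {f g : CharGroup b →+ G}
    (h : ∀ i, f (weight b i) = g (weight b i)) : f = g := by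
  have : f.toIntLinearMap = g.toIntLinearMap := by
    apply Submodule.linearMap_qext
    refine Finsupp.lhom_ext' fun i => LinearMap.ext_ring ?_
    exact h i
  exact AddMonoidHom.ext fun x => LinearMap.congr_fun this x

/-- For G the units of A, the condition on u says exactly that diag(u_i) is an automorphism of A ⊗
E. -/
theorem exists_charGroup_hom {G : Type*} [AddCommGroup G] (u : ι → G)
    (hu : ∀ i j, b.repr (b i * b i) j ≠ 0 → 2 • u i = u j) :
    ∃ f : CharGroup b →+ G, ∀ i, f (weight b i) = u i := by
  have hle : charRel b ≤ LinearMap.ker (Finsupp.linearCombination ℤ u) := by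
    unfold charRel
    rw [Submodule.span_le]
    rintro _ ⟨i, j, h, rfl⟩
    change Finsupp.linearCombination ℤ u _ = 0
    rw [map_sub, map_smul, Finsupp.linearCombination_single, Finsupp.linearCombination_single,
      one_smul, one_smul, ofNat_zsmul, hu i j h, sub_self]
  refine ⟨((charRel b).liftQ _ hle).toAddMonoidHom, fun i => ?_⟩
  change Finsupp.linearCombination ℤ u (Finsupp.single i 1) = u i
  rw [Finsupp.linearCombination_single, one_smul]

theorem span_range_weight (b : Module.Basis ι K E) :
    Submodule.span ℤ (Set.range (weight b)) = ⊤ := by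
  rw [eq_top_iff, ← Submodule.range_mkQ (charRel b), LinearMap.range_eq_map,
    ← (Finsupp.basisSingleOne (R := ℤ) (ι := ι)).span_eq, Submodule.map_span, ← Set.range_comp]
  refine Submodule.span_mono ?_
  rintro _ ⟨i, rfl⟩
  exact ⟨i, by simp [weight]⟩

/-- The character group of the diagonal automorphisms of a perfect evolution algebra is finite. -/
theorem finite_charGroup [Finite ι] (h : ∀ j, ∃ i, b.repr (b i * b i) j ≠ 0) :
    Finite (CharGroup b) := by
  -- Every weight is twice another weight, so M = 2M. Nakayama's lemma then gives an odd integer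
  -- that annihilates M, and a finitely generated torsion group is finite.
  have hle : (⊤ : Submodule ℤ (CharGroup b)) ≤ Ideal.span {(2 : ℤ)} • ⊤ := by
    rw [← span_range_weight, Submodule.span_le]
    rintro _ ⟨j, rfl⟩
    obtain ⟨i, hi⟩ := h j
    rw [← two_nsmul_weight hi, ← ofNat_zsmul, span_range_weight]
    exact Submodule.smul_mem_smul (Ideal.mem_span_singleton_self 2) trivial
  obtain ⟨a, ha, ha'⟩ := Submodule.exists_sub_one_mem_and_smul_eq_zero_of_fg_of_le_smul _ _
    (Module.finite_def.1 (inferInstance : Module.Finite ℤ (CharGroup b))) hle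
  have ha0 : a ≠ 0 := by
    rintro rfl
    rw [Ideal.mem_span_singleton] at ha
    omega
  refine Module.finite_of_fg_torsion _ fun x => ?_
  exact ⟨⟨a, mem_nonZeroDivisors_of_ne_zero ha0⟩, ha' x trivial⟩

end CharGroup

/-! ### The structure matrix of a perfect evolution algebra -/

section Perfect

variable {K E ι : Type*} [Field K] [NonUnitalNonAssocRing E] [Module K E]
  [IsScalarTower K E E] [SMulCommClass K E E] [Fintype ι] {b : Module.Basis ι K E}

theorem span_sq_eq_top (hb : IsNaturalBasis b) (hE : IsPerfect K E) :
    Submodule.span K (Set.range fun i => b i * b i) = ⊤ := by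
  rw [eq_top_iff, ← (show Submodule.span K {z : E | ∃ x y : E, z = x * y} = ⊤ from hE),
    Submodule.span_le]
  rintro _ ⟨x, y, rfl⟩
  rw [← b.sum_repr x, ← b.sum_repr y, Finset.sum_mul]
  refine Submodule.sum_mem _ fun i _ => ?_
  rw [Finset.mul_sum]
  refine Submodule.sum_mem _ fun j _ => ?_
  rw [smul_mul_assoc, mul_smul_comm]
  refine Submodule.smul_mem _ _ (Submodule.smul_mem _ _ ?_)
  by_cases hij : i = j
  · subst hij
    exact Submodule.subset_span ⟨i, rfl⟩
  · rw [hb i j hij]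
    exact Submodule.zero_mem _

/-- Otherwise E² would lie in the hyperplane where the j-th coordinate vanishes. -/
theorem exists_repr_sq_ne_zero (hb : IsNaturalBasis b) (hE : IsPerfect K E) (j : ι) :
    ∃ i, b.repr (b i * b i) j ≠ 0 := by
  by_contra! h
  have hle : (⊤ : Submodule K E) ≤ LinearMap.ker (b.coord j) := by
    rw [← span_sq_eq_top hb hE, Submodule.span_le]
    rintro _ ⟨i, rfl⟩
    exact h i
  have h1 : b.coord j (b j) = 0 := hle trivial
  simp at h1

/-- The structure matrix of a perfect evolution algebra has a left inverse. -/
theorem exists_left_inverse_structure [DecidableEq ι] (hb : IsNaturalBasis b)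
    (hE : IsPerfect K E) :
    ∃ N : Matrix ι ι K, ∀ i k, ∑ m, N i m * b.repr (b k * b k) m = if i = k then 1 else 0 := by
  have hcard : Fintype.card ι = Module.finrank K E := (Module.finrank_eq_card_basis b).symm
  -- The n squares span an n-dimensional space, so they form a basis; N is the change of basis
  -- matrix.
  let B := basisOfTopLeSpanOfCardEqFinrank (fun i => b i * b i) (span_sq_eq_top hb hE).ge hcard
  have hB : ∀ i, B i = b i * b i := fun i => by simp [B]
  refine ⟨B.toMatrix b, fun i k => ?_⟩
  have h := congrFun (congrFun (B.toMatrix_mul_toMatrix_flip b) i) k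
  rw [Matrix.mul_apply, Matrix.one_apply] at h
  rw [← h]
  refine Finset.sum_congr rfl fun m _ => ?_
  rw [b.toMatrix_apply, hB]

end Perfect

/-! ### ℋ as a group algebra when the automorphism group is trivial -/

section Diagonal

variable {K E ι : Type*} [Field K] [NonUnitalNonAssocRing E] [Module K E]
  [Fintype ι] [DecidableEq ι] {b : Module.Basis ι K E}

/-- A character of the character group gives a diagonal point of `ℋ`. -/
theorem exists_diagonal_point (hb : IsNaturalBasis b) {A : Type*} [CommRing A] [Algebra K A]
    (χ : CharGroup b →+ Additive Aˣ) :
    ∃ F : HAlg b →ₐ[K] A, ∀ i j,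
      F (entry b i j) = if i = j then (((χ (weight b i)).toMul : Aˣ) : A) else 0 := by
  let u : ι → Aˣ := fun i => (χ (weight b i)).toMul
  have hu : ∀ i m, b.repr (b i * b i) m ≠ 0 → u i * u i = u m := fun i m h => by
    rw [← sq, ← toMul_nsmul, ← map_nsmul, two_nsmul_weight h]
  -- The generic matrix goes to diag(u_i), so the extra variable must go to the inverse of ∏ u_i.
  let Φ : MvPolynomial (Option (ι × ι)) K →ₐ[K] A :=
    MvPolynomial.aeval fun o => o.elim (((∏ i, u i)⁻¹ : Aˣ) : A)
      fun p => if p.1 = p.2 then (u p.1 : A) else 0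
  have hΦ : ∀ i j, Φ (genMat K ι i j) = if i = j then (u i : A) else 0 := fun i j => by
    simp [Φ, genMat]
  have hC : ∀ a : K, Φ (MvPolynomial.C a) = algebraMap K A a := fun a => by
    rw [← MvPolynomial.algebraMap_eq, AlgHom.commutes]
  have hle : autIdeal b ≤ RingHom.ker (Φ : MvPolynomial (Option (ι × ι)) K →+* A) := by
    unfold autIdeal
    rw [Ideal.span_le]
    rintro f (rfl | ⟨i, j, m, rfl⟩)
    · change (Φ : MvPolynomial (Option (ι × ι)) K →+* A) _ = 0
      have h1 : (Φ : MvPolynomial (Option (ι × ι)) K →+* A).mapMatrix (genMat K ι) =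
          Matrix.diagonal fun i => (u i : A) := by
        ext i j
        rw [Matrix.diagonal_apply]
        exact hΦ i j
      have h2 : (Φ : MvPolynomial (Option (ι × ι)) K →+* A) (MvPolynomial.X none) =
          (((∏ i, u i)⁻¹ : Aˣ) : A) := by
        simp [Φ]
      rw [map_sub, map_mul, map_one, RingHom.map_det, h1, h2, Matrix.det_diagonal,
        ← Units.coe_prod, Units.inv_mul, sub_self]
    · change Φ _ = 0
      simp only [multRel, map_sub, map_sum, map_mul, hC, hΦ]
      simp only [mul_ite, ite_mul, mul_zero, zero_mul, Finset.sum_ite_eq, Finset.sum_ite_eq',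
        Finset.mem_univ, if_true]
      by_cases hij : i = j
      · subst hij
        by_cases hm : b.repr (b i * b i) m = 0
        · simp [hm]
        · rw [← hu i m hm, Units.val_mul]
          ring
      · simp [hb i j hij]
  refine ⟨Ideal.Quotient.liftₐ (autIdeal b) Φ fun a ha => hle ha, fun i j => ?_⟩
  exact hΦ i j

theorem entry_rel (b : Module.Basis ι K E) (i j m : ι) :
    (∑ l, b.repr (b i * b j) l • entry b m l) =
      ∑ k, ∑ l, b.repr (b k * b l) m • (entry b k i * entry b l j) := by
  have h := ptMat_rel b (AlgHom.id K (HAlg b)) i j m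
  simp only [ptMat, Matrix.of_apply, AlgHom.id_apply] at h
  refine (Finset.sum_congr rfl fun l _ => Algebra.smul_def _ _).trans (h.trans ?_)
  exact Finset.sum_congr rfl fun k _ => Finset.sum_congr rfl fun l _ =>
    (mul_comm _ _).trans (Algebra.smul_def _ _).symm

theorem sum_entry_rel (hb : IsNaturalBasis b) (i j m : ι) :
    (∑ l, b.repr (b i * b j) l • entry b m l) =
      ∑ k, b.repr (b k * b k) m • (entry b k i * entry b k j) := by
  rw [entry_rel]
  refine Finset.sum_congr rfl fun k _ => ?_
  refine Finset.sum_eq_single k (fun l _ hl => ?_) (fun h => absurd (Finset.mem_univ k) h)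
  rw [hb k l (Ne.symm hl)]
  simp

variable [IsScalarTower K E E] [SMulCommClass K E E]

/-- In a row of the generic automorphism of a perfect evolution algebra, products of distinct
entries vanish. -/
theorem entry_mul_entry (hb : IsNaturalBasis b) (hE : IsPerfect K E) (k : ι) {i j : ι}
    (hij : i ≠ j) : entry b k i * entry b k j = 0 := by
  obtain ⟨N, hN⟩ := exists_left_inverse_structure hb hE
  -- This is multiplicativity for e_i e_j = 0: the structure matrix kills the vector of products
  -- a_{li} a_{lj}. Its left inverse N then isolates each product.
  have h0 : ∀ m, ∑ l, b.repr (b l * b l) m • (entry b l i * entry b l j) = 0 := fun m => by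
    rw [← sum_entry_rel hb, hb i j hij]
    simp
  calc entry b k i * entry b k j
      = ∑ l, (∑ m, N k m * b.repr (b l * b l) m) • (entry b l i * entry b l j) := by
        simp only [hN, ite_smul, one_smul, zero_smul, Finset.sum_ite_eq, Finset.mem_univ, if_true]
    _ = ∑ m, N k m • ∑ l, b.repr (b l * b l) m • (entry b l i * entry b l j) := by
        simp only [Finset.sum_smul, Finset.smul_sum, mul_smul]
        exact Finset.sum_comm
    _ = 0 := by simp only [h0, smul_zero, Finset.sum_const_zero]

variable [IsAlgClosed K]

/-- The entry takes the value 1 at every point. As ℋ may be non-reduced, this makes it a unit but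
not necessarily 1. -/
theorem isUnit_entry_self (h : algAut K E = ⊥) (k : ι) : IsUnit (entry b k k) :=
  isUnit_of_forall_algHom_ne_zero (K := K) _ fun φ => by
    rw [apply_entry_of_algAut_eq_bot h, if_pos rfl]
    exact one_ne_zero

theorem entry_eq_zero (hb : IsNaturalBasis b) (hE : IsPerfect K E) (h : algAut K E = ⊥)
    {k j : ι} (hkj : k ≠ j) : entry b k j = 0 :=
  (isUnit_entry_self h k).mul_right_eq_zero.1 (entry_mul_entry hb hE k hkj)

/-- With only diagonal entries left, the e_j-coefficient of multiplicativity for e_i² reads ω_ji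
a_jj = ω_ji a_ii². -/
theorem entry_sq (hb : IsNaturalBasis b) (hE : IsPerfect K E) (h : algAut K E = ⊥)
    {i j : ι} (hij : b.repr (b i * b i) j ≠ 0) : entry b i i * entry b i i = entry b j j := by
  have h1 := sum_entry_rel hb i i j
  rw [Finset.sum_eq_single j (fun l _ hl => by
      rw [entry_eq_zero hb hE h (Ne.symm hl), smul_zero])
      (fun h => absurd (Finset.mem_univ j) h),
    Finset.sum_eq_single i (fun l _ hl => by
      rw [entry_eq_zero hb hE h hl, zero_mul, smul_zero])
      (fun h => absurd (Finset.mem_univ i) h)] at h1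
  exact ((smul_right_injective (HAlg b) hij) h1).symm

/-- The diagonal entries define a character of the character group in `ℋ`. -/
theorem exists_universal_character (hb : IsNaturalBasis b) (hE : IsPerfect K E)
    (h : algAut K E = ⊥) :
    ∃ ψ : CharGroup b →+ Additive (HAlg b)ˣ,
      ∀ i, (((ψ (weight b i)).toMul : (HAlg b)ˣ) : HAlg b) = entry b i i := by
  obtain ⟨ψ, hψ⟩ := exists_charGroup_hom (b := b)
    (fun i => Additive.ofMul (isUnit_entry_self (b := b) h i).unit) (fun i j hij => by
      rw [← ofMul_pow]
      refine congrArg Additive.ofMul (Units.ext ?_)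
      rw [Units.val_pow_eq_pow_val, sq]
      exact entry_sq hb hE h hij)
  exact ⟨ψ, fun i => by rw [hψ]; rfl⟩

omit [IsAlgClosed K] in
/-- If `E` has only the trivial automorphism, then all characters with values in `K` are
trivial. -/
theorem character_eq_zero (hb : IsNaturalBasis b) (h : algAut K E = ⊥)
    (χ : CharGroup b →+ Additive Kˣ) : χ = 0 := by
  obtain ⟨F, hF⟩ := exists_diagonal_point hb χ
  refine charGroup_hom_ext fun i => ?_
  have h1 := hF i i
  rw [apply_entry_of_algAut_eq_bot h, if_pos rfl, if_pos rfl] at h1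
  exact congrArg Additive.ofMul (Units.ext h1.symm)

/-- If p were nonzero in K, a primitive p-th root of unity would exist, and sending the j-th cyclic
factor to it would give a nontrivial character with values in K. -/
theorem natCast_eq_zero_of_prime_dvd (hb : IsNaturalBasis b) (h : algAut K E = ⊥) {J : Type*}
    {n : J → ℕ} (e : CharGroup b ≃+ DirectSum J fun j => ZMod (n j)) (j : J) {p : ℕ}
    (hp : p.Prime) (hpj : p ∣ n j) : (p : K) = 0 := by
  classical
  by_contra hpK
  have : NeZero (p : K) := ⟨hpK⟩
  obtain ⟨z, hz⟩ := HasEnoughRootsOfUnity.exists_primitiveRoot K p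
  obtain ⟨ζ, rfl⟩ := hz.isUnit hp.ne_zero
  have hζ : IsPrimitiveRoot ζ p := IsPrimitiveRoot.coe_units_iff.1 hz
  have hζn : ζ ^ n j = 1 := (hζ.pow_eq_one_iff_dvd _).2 hpj
  let f : (DirectSum J fun j => ZMod (n j)) →+ Additive Kˣ :=
    (zmodUnitHom (n j) ζ hζn).comp (DFinsupp.evalAddMonoidHom j)
  have h0 := character_eq_zero hb h (f.comp e.toAddMonoidHom)
  have h1 := DFunLike.congr_fun h0 (e.symm (DirectSum.of (fun j => ZMod (n j)) j 1))
  change f (e (e.symm _)) = 0 at h1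
  rw [e.apply_symm_apply] at h1
  change zmodUnitHom (n j) ζ hζn (DirectSum.of (fun j => ZMod (n j)) j 1 j) = 0 at h1
  rw [DirectSum.of_eq_same, zmodUnitHom_one, ofMul_eq_zero] at h1
  exact hζ.ne_one hp.one_lt h1

/-- A perfect evolution algebra over an algebraically closed field that has only the trivial
automorphism has a trivial automorphism group scheme or one of truncated polynomial form. -/
theorem isTruncPoly_of_algAut_eq_bot (hb : IsNaturalBasis b) (hE : IsPerfect K E)
    (h : algAut K E = ⊥) (hK : IsEmpty (HAlg b ≃ₐ[K] K)) :
    ∃ q : ℕ, q.Prime ∧ CharP K q ∧ IsTruncPoly K q (HAlg b) := by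
  obtain ⟨ψ, hψ⟩ := exists_universal_character hb hE h
  have hfin : Finite (CharGroup b) := finite_charGroup (exists_repr_sq_ne_zero hb hE)
  obtain ⟨J, hJ, n, hn, ⟨e⟩⟩ := AddCommGroup.equiv_directSum_zmod_of_finite' (CharGroup b)
  -- If M were trivial, all diagonal entries would be 1 and the counit would be an isomorphism ℋ ≅
  -- K.
  have hne : Nonempty J := by
    by_contra hJ0
    rw [not_nonempty_iff] at hJ0
    have hsub : Subsingleton (CharGroup b) := e.injective.subsingleton
    have hid : (Algebra.ofId K (HAlg b)).comp (counitH b) = AlgHom.id K (HAlg b) := by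
      refine HAlg.algHom_ext fun i j => ?_
      rw [AlgHom.comp_apply, apply_entry_of_algAut_eq_bot h, AlgHom.id_apply]
      split_ifs with hij
      · subst hij
        rw [map_one, ← hψ, Subsingleton.elim (weight b i) 0, map_zero]
        rfl
      · rw [map_zero, entry_eq_zero hb hE h hij]
    exact hK.elim (AlgEquiv.ofAlgHom (counitH b) (Algebra.ofId K (HAlg b))
      (AlgHom.ext fun x => (counitH b).commutes x) hid)
  obtain ⟨j₀⟩ := hne
  obtain ⟨q, hq, hqj⟩ := Nat.exists_prime_and_dvd (hn j₀).ne'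
  have hchar : CharP K q := by
    obtain ⟨p, hp⟩ := CharP.exists K
    have hpq : p ∣ q :=
      (CharP.cast_eq_zero_iff K p q).1 (natCast_eq_zero_of_prime_dvd hb h e j₀ hq hqj)
    rcases (Nat.dvd_prime hq).1 hpq with rfl | rfl
    · exact absurd rfl (CharP.char_ne_one K 1)
    · exact hp
  have hfact : Fact q.Prime := ⟨hq⟩
  -- Every prime factor of n_j vanishes in K, hence equals q.
  have hpow : ∀ j, n j = q ^ (n j).primeFactorsList.length := fun j =>
    Nat.eq_prime_pow_of_unique_prime_dvd (by have := hn j; omega) fun {d} hd hdj =>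
      ((Nat.prime_dvd_prime_iff_eq hq hd).1 ((CharP.cast_eq_zero_iff K q d).1
        (natCast_eq_zero_of_prime_dvd hb h e j hd hdj))).symm
  let σ : J ≃ Fin (Fintype.card J) := Fintype.equivFin J
  let r : Fin (Fintype.card J) → ℕ := fun i => (n (σ.symm i)).primeFactorsList.length
  have hr : ∀ i, n (σ.symm i) = q ^ r i := fun i => hpow _
  let e₁ : (DirectSum J fun j => ZMod (n j)) ≃+
      DirectSum (Fin (Fintype.card J)) fun i => ZMod (n (σ.symm i)) :=
    DirectSum.equivCongrLeft σ
  let e₂ : (DirectSum (Fin (Fintype.card J)) fun i => ZMod (n (σ.symm i))) ≃+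
      DirectSum (Fin (Fintype.card J)) fun i => ZMod (q ^ r i) :=
    DFinsupp.mapRange.addEquiv fun i => (ZMod.ringEquivCongr (hr i)).toAddEquiv
  refine ⟨q, hq, hchar, Fintype.card J, Fintype.card_pos_iff.2 ⟨j₀⟩, r, fun i => ?_,
    nonempty_algEquiv_truncPoly q ψ (fun A _ _ χ => ?_) (fun F F' hF => ?_) r
      ((e.trans e₁).trans e₂)⟩
  · rw [Nat.one_le_iff_ne_zero]
    intro h0
    have h1 := hr i
    rw [h0, pow_zero] at h1
    exact (hn _).ne' h1
  · obtain ⟨F, hF⟩ := exists_diagonal_point hb χ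
    -- The weights generate M, so agreement on the diagonal entries gives agreement on all of M.
    have hχ : (MonoidHom.toAdditive (Units.map (F : HAlg b →* A))).comp ψ = χ := by
      refine charGroup_hom_ext fun i => congrArg Additive.ofMul (Units.ext ?_)
      change F _ = _
      rw [hψ, hF, if_pos rfl]
      rfl
    exact ⟨F, fun x => congrArg (fun a : Additive Aˣ => ((a.toMul : Aˣ) : A))
      (DFunLike.congr_fun hχ x)⟩
  · refine HAlg.algHom_ext fun i j => ?_
    by_cases hij : i = j
    · subst hij
      rw [← hψ, hF]
    · rw [entry_eq_zero hb hE h hij, map_zero, map_zero]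

end Diagonal

end EvoAlg

end

theorem mainTheorem10 {K E ι : Type*} [Field K] [NonUnitalNonAssocRing E] [Module K E]
    [IsScalarTower K E E] [SMulCommClass K E E] [Fintype ι] [DecidableEq ι]
    (b : Module.Basis ι K E) (hb : EvoAlg.IsNaturalBasis b) (c : Fin 4 → K)
    (hTH : ∃ f : EvoAlg.Tp b c →ₙₐ[K] EvoAlg.HAlg b, Function.Bijective f) :
    (EvoAlg.IsPerfect K E →
      ((∀ z : EvoAlg.Tp b c, EvoAlg.starT b c z = z) →
        (¬ EvoAlg.IsAssoc E → ¬ Function.Injective (EvoAlg.rho b c)) ∧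
        LinearMap.ker (EvoAlg.rho b c) ≠ ⊤ ∧
        ∃ J : TwoSidedIdeal E, (J : Set E) = (LinearMap.ker (EvoAlg.rho b c) : Set E) ∧
          EvoAlg.IsAssoc J.ringCon.Quotient) ∧
      ((∃ z : EvoAlg.Tp b c, EvoAlg.starT b c z ≠ z) →
        IsEmpty (EvoAlg.HAlg b ≃ₐ[K] K) ∧
        (IsAlgClosed K →
          EvoAlg.algAut K E ≠ ⊥ ∨
            ∃ q : ℕ, q.Prime ∧ CharP K q ∧ EvoAlg.IsTruncPoly K q (EvoAlg.HAlg b)))) ∧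
    (EvoAlg.IsSimpleAlg K E → ¬ EvoAlg.IsAssoc E →
      (EvoAlg.algAut K E ≠ ⊥ ∨
        ∃ q : ℕ, q.Prime ∧ CharP K q ∧ EvoAlg.IsTruncPoly K q (EvoAlg.HAlg b)) ∧
      (CharZero K → EvoAlg.algAut K E ≠ ⊥)) := by
  obtain ⟨f, hf⟩ := hTH
  refine ⟨fun hE => ⟨EvoAlg.ker_rho_of_starT_eq hb hf, ?_⟩, fun hE hE' => ?_⟩
  · rintro ⟨z, hz⟩
    have hK : IsEmpty (EvoAlg.HAlg b ≃ₐ[K] K) :=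
      ⟨fun e => hz (EvoAlg.starT_eq_of_algEquiv hf e z)⟩
    refine ⟨hK, fun hcl => ?_⟩
    by_cases h : EvoAlg.algAut K E = ⊥
    · exact Or.inr (EvoAlg.isTruncPoly_of_algAut_eq_bot hb hE h hK)
    · exact Or.inl h
  -- For simple E the first alternative always holds, over any field.
  · have h := EvoAlg.algAut_ne_bot_of_isSimpleAlg hb hf hE hE'
    exact ⟨Or.inl h, fun _ => h⟩
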